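/- Let $p\ge 1$, let $S$ be a $p\times p$ real symmetric positive definite matrix, $N=\mathrm{diag}(n_1,\dots,n_p)$ with all $n_i>0$, and $v\in\mathbb R$ with $2v+\mathrm{tr}(N)/p>2p$. A random $p\times p$ matrix $\Sigma$ follows the modified inverted Wishart distribution $MIW_p(S,N,v)$ if its law is concentrated on the symmetric positive definite matrices and has there, with respect to $d\Sigma=\prod_{i\le j}d\sigma_{ij}$, the density $$p(\Sigma)=c\,|\Sigma|^{-\{v+\mathrm{tr}(N)/(2p)\}}\exp\Big\{-\tfrac12\,\mathrm{tr}\big(N^{1/2}SN^{1/2}\Sigma^{-1}\big)\Big\},$$ where $c$ is the normalizing constant, which does not depend on $\Sigma$. Suppose that $\Sigma=(\sigma_{ij})\sim MIW_p(S,N,v)$ with $S=(s_{ij})$. (i) For $1\le q<p$ let $\Sigma_{11},S_{11},N_1$ be the leading $q\times q$ blocks of $\Sigma,S,N$. Then $\Sigma_{11}\sim MIW_q(S_{11},N_1,v_1)$, where $$v_1=v-p+q+\frac{\mathrm{tr}(N)}{2p}-\frac{\mathrm{tr}(N_1)}{2q};$$ in particular these parameters are again admissible, that is, $S_{11}$ is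 positive definite, $N_1$ has positive diagonal, and $2v_1+\mathrm{tr}(N_1)/q>2q$. (ii) For every $1\le i\le p$, with $v_i=v-p+1+\mathrm{tr}(N)/(2p)-n_i/2$, one has $\sigma_{ii}\sim MIW_1(s_{ii},n_i,v_i)$, and $\sigma_{ii}$ has the inverted gamma distribution $IG(v_i+n_i/2-1,\;n_is_{ii}/2)$, where $v_i+n_i/2-1>0$ and $IG(a,b)$ with $a,b>0$ has density $\frac{b^a}{\Gamma(a)}x^{-a-1}e^{-b/x}$ on $(0,\infty)$. -/

import Mathlib

open MeasureTheory ProbabilityTheory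
open scoped ENNReal

noncomputable section

/-- Matrices carry the product (entrywise Borel) σ-algebra. -/
instance matrixMeasurableSpace {m n : Type*} : MeasurableSpace (Matrix m n ℝ) :=
  inferInstanceAs (MeasurableSpace (m → n → ℝ))

/-- The symmetric `p × p` matrix with prescribed entries on and above the diagonal. -/
def symOfUpper {p : ℕ} (x : {ij : Fin p × Fin p // ij.1 ≤ ij.2} → ℝ) :
    Matrix (Fin p) (Fin p) ℝ :=
  Matrix.of fun i j => x ⟨(min i j, max i j), min_le_max⟩

lemma measurable_symOfUpper {p : ℕ} : Measurable (symOfUpper (p := p)) :=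
  measurable_pi_iff.2 fun _ => measurable_pi_iff.2 fun _ => measurable_pi_apply _

/-- The measure `dΣ = ∏_{i ≤ j} dσ_ij`: Lebesgue measure in the `p (p + 1) / 2` free entries of a
symmetric matrix, regarded as a measure on all `p × p` matrices, carried by the symmetric ones. -/
def symVolume (p : ℕ) : Measure (Matrix (Fin p) (Fin p) ℝ) :=
  Measure.map symOfUpper
    (volume : Measure ({ij : Fin p × Fin p // ij.1 ≤ ij.2} → ℝ))

/-- The matrix `N^{1/2}` for a diagonal matrix `N` with nonnegative diagonal. -/
def diagSqrt {p : ℕ} (N : Matrix (Fin p) (Fin p) ℝ) : Matrix (Fin p) (Fin p) ℝ :=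
  Matrix.diagonal fun i => √(N i i)

/-- The unnormalised density
`|Σ|^{-(v + tr N / (2p))} etr(-(1/2) N^{1/2} S N^{1/2} Σ⁻¹)` on the positive definite matrices,
extended by `0` to all matrices. -/
def miwKernel {p : ℕ} (S N : Matrix (Fin p) (Fin p) ℝ) (v : ℝ) :
    Matrix (Fin p) (Fin p) ℝ → ℝ≥0∞ :=
  Set.indicator {X | X.PosDef} fun X =>
    ENNReal.ofReal (X.det ^ (-(v + N.trace / (2 * p))) *
      Real.exp (-(1 / 2) * (diagSqrt N * S * diagSqrt N * X⁻¹).trace))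

/-- The measure whose density with respect to `dΣ` is `c` times the kernel, `c` being the
normalising constant, that is the reciprocal of the integral of the kernel. -/
def miwMeasure {p : ℕ} (S N : Matrix (Fin p) (Fin p) ℝ) (v : ℝ) :
    Measure (Matrix (Fin p) (Fin p) ℝ) :=
  (symVolume p).withDensity fun X =>
    (∫⁻ Y, miwKernel S N v Y ∂(symVolume p))⁻¹ * miwKernel S N v X

/-- `X ~ MIW_p(S, N, v)` under `P`: the parameters are admissible (`S` positive definite, `N`
diagonal with positive diagonal, and `k = 2v + tr N / p > 2p`) and the law of `X` is the
modified inverted Wishart distribution with these parameters. -/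
structure HasMIWLaw {Ω : Type*} [MeasurableSpace Ω] {p : ℕ}
    (X : Ω → Matrix (Fin p) (Fin p) ℝ) (S N : Matrix (Fin p) (Fin p) ℝ) (v : ℝ)
    (P : Measure Ω) : Prop where
  posDef : S.PosDef
  isDiag : N.IsDiag
  diag_pos : ∀ i, 0 < N i i
  two_mul_lt : 2 * (p : ℝ) < 2 * v + N.trace / p
  hasLaw : HasLaw X (miwMeasure S N v) P

/-- The inverted gamma distribution `IG(a, b)`, with density
`b^a / Γ(a) x^{-(a + 1)} exp(-b / x)` on `(0, ∞)`. -/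
def invGammaMeasure (a b : ℝ) : Measure ℝ :=
  volume.withDensity (Set.indicator (Set.Ioi 0) fun x =>
    ENNReal.ofReal (b ^ a / Real.Gamma a * x ^ (-(a + 1)) * Real.exp (-(b / x))))

/-- `Y ~ IG(a, b)` under `P`, with `a, b > 0`. -/
structure HasInvGammaLaw {Ω : Type*} [MeasurableSpace Ω] (Y : Ω → ℝ) (a b : ℝ)
    (P : Measure Ω) : Prop where
  shape_pos : 0 < a
  scale_pos : 0 < b
  hasLaw : HasLaw Y (invGammaMeasure a b) P

/-- The leading `q × q` block of a `p × p` matrix. -/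
def leadingBlock {p q : ℕ} (h : q ≤ p) (A : Matrix (Fin p) (Fin p) ℝ) :
    Matrix (Fin q) (Fin q) ℝ :=
  A.submatrix (Fin.castLE h) (Fin.castLE h)

end

/-!
Split `Σ` into blocks `A`, `B`, `Bᵀ`, `D`, where `A` is the block whose law is wanted, and pass to
the coordinates `A`, `U = A⁻¹ B`, `T = D - Bᵀ A⁻¹ B`. With the block shear `L = [1, U; 0, 1]` one
has `Σ = Lᵀ diag(A, T) L`, hence `|Σ| = |A| |T|` and
`tr (M Σ⁻¹) = tr (M₁₁ A⁻¹) + tr (Q(U) T⁻¹)`, where `Q(U)` (`residualScale`) does not involve `A`. The kernel is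
therefore a function of `A` times a function of `(U, T)` (`invWishartKernel_regression`), and the
substitution `B = A U` contributes the Jacobian `|A| ^ r`, `r` being the size of `D`
(`lintegral_eq_lintegral_mul_left`). The marginal density of `A` is thus proportional to the kernel
with scale `M₁₁` and with exponent lowered by `r` (`exists_map_submatrix_invWishart`).

No normalising constant has to be evaluated for this: two probability measures proportional to the
same measure are equal (`eq_miwMeasure_of_eq_smul`). The argument works for the principal block along
any injection of index types, so leading blocks and single diagonal entries are two instances of
`HasMIWLaw.submatrix`. For that reason Lebesgue measure on symmetric matrices is indexed by
unordered pairs, which makes it independent of an ordering of the indices. In dimension one the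
kernel is that of an inverted gamma law, whose total mass is the gamma integral under `x ↦ x⁻¹`.
-/

/-! ### Measurability of matrix operations -/

section Measurability

variable {m n : Type*}

instance matrixBorelSpace [Countable m] [Countable n] : BorelSpace (Matrix m n ℝ) :=
  inferInstanceAs (BorelSpace (m → n → ℝ))

lemma measurable_matrix_iff {α : Type*} [MeasurableSpace α] {F : α → Matrix m n ℝ} :
    Measurable F ↔ ∀ i j, Measurable fun a => F a i j :=
  measurable_pi_iff.trans (forall_congr' fun _ => measurable_pi_iff)

lemma measurable_matrix_apply (i : m) (j : n) : Measurable fun X : Matrix m n ℝ => X i j :=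
  (measurable_pi_apply j).comp (measurable_pi_apply (X := fun _ : m => n → ℝ) i)

lemma measurable_submatrix {m' n' : Type*} (f : m' → m) (g : n' → n) :
    Measurable fun X : Matrix m n ℝ => X.submatrix f g :=
  measurable_matrix_iff.2 fun i j => measurable_matrix_apply (f i) (g j)

/-- Positive definite means positive semidefinite, a closed condition, and nonsingular, an open
one. -/
lemma measurableSet_posDef [Fintype n] [DecidableEq n] :
    MeasurableSet {X : Matrix n n ℝ | X.PosDef} := by
  have h : {X : Matrix n n ℝ | X.PosDef} = ({X | X.IsHermitian} ∩
      ⋂ x : n → ℝ, {X | 0 ≤ star x ⬝ᵥ (X.mulVec x)}) ∩ {X | X.det ≠ 0} := by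
    ext X
    constructor
    · intro h
      exact ⟨⟨h.isHermitian, Set.mem_iInter.2 fun x => h.posSemidef.dotProduct_mulVec_nonneg x⟩,
        h.det_pos.ne'⟩
    · rintro ⟨⟨h₁, h₂⟩, h₃⟩
      have := Matrix.PosSemidef.of_dotProduct_mulVec_nonneg h₁ (Set.mem_iInter.1 h₂)
      exact this.posDef_iff_det_ne_zero.2 h₃
  rw [h]
  refine (IsClosed.measurableSet ?_).inter (IsOpen.measurableSet ?_)
  · refine (isClosed_eq (by fun_prop) continuous_id).inter (isClosed_iInter fun x => ?_)
    exact isClosed_le continuous_const (by fun_prop)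
  · exact isOpen_ne_fun (by fun_prop) continuous_const

lemma measurable_matrix_inv [Fintype n] [DecidableEq n] :
    Measurable fun X : Matrix n n ℝ => X⁻¹ := by
  have hd : Measurable fun X : Matrix n n ℝ => X.det :=
    (Continuous.matrix_det continuous_id).measurable
  have ha : Measurable fun X : Matrix n n ℝ => X.adjugate :=
    (Continuous.matrix_adjugate continuous_id).measurable
  refine measurable_matrix_iff.2 fun i j => ?_
  simp only [Matrix.inv_def, Matrix.smul_apply, smul_eq_mul, Ring.inverse_eq_inv']
  exact hd.inv.mul ((measurable_matrix_apply i j).comp ha)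

end Measurability

/-! ### Lebesgue measure on symmetric matrices -/

/-- The symmetric matrix whose entries are given by a function on unordered pairs of indices. -/
def symMatrix {ι : Type*} (x : Sym2 ι → ℝ) : Matrix ι ι ℝ :=
  Matrix.of fun i j => x s(i, j)

lemma measurable_symMatrix {ι : Type*} : Measurable (symMatrix (ι := ι)) :=
  measurable_matrix_iff.2 fun _ _ => measurable_pi_apply _

/-- Lebesgue measure in the free entries of a symmetric matrix with an arbitrary finite index type.
Unordered pairs replace the pairs `i ≤ j`, so that no order on the indices is needed. -/
noncomputable def symLebesgue (ι : Type*) [Fintype ι] [DecidableEq ι] : Measure (Matrix ι ι ℝ) :=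
  Measure.map symMatrix (volume : Measure (Sym2 ι → ℝ))

section SymLebesgue

variable {ι κ τ : Type*} [Fintype ι] [DecidableEq ι] [Fintype κ] [DecidableEq κ]
  [Fintype τ] [DecidableEq τ]

instance : SFinite (symLebesgue ι) := by
  unfold symLebesgue; infer_instance

lemma measurePreserving_comp_equiv {α β : Type*} [Fintype α] [Fintype β] (e : α ≃ β) :
    MeasurePreserving (fun x : β → ℝ => x ∘ e) volume volume := by
  convert volume_measurePreserving_piCongrLeft (fun _ : α => ℝ) e.symm using 1
  ext x a
  obtain ⟨b, rfl⟩ := e.symm.surjective a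
  rw [MeasurableEquiv.coe_piCongrLeft, Equiv.piCongrLeft_apply_apply]
  simp

lemma symVolume_eq_symLebesgue (p : ℕ) : symVolume p = symLebesgue (Fin p) := by
  rw [symVolume, symLebesgue, ← (measurePreserving_comp_equiv (Sym2.sortEquiv (α := Fin p))).map_eq,
    Measure.map_map measurable_symMatrix (measurePreserving_comp_equiv _).measurable]
  rfl

/-- Relabelling of unordered pairs. -/
def sym2Relabel {α β : Type*} (e : α ≃ β) : Sym2 α ≃ Sym2 β where
  toFun := Sym2.map e
  invFun := Sym2.map e.symm
  left_inv s := by simp [Sym2.map_map]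
  right_inv s := by simp [Sym2.map_map]

lemma map_submatrix_symLebesgue (e : ι ≃ κ) :
    Measure.map (fun X : Matrix κ κ ℝ => X.submatrix e e) (symLebesgue κ) = symLebesgue ι := by
  rw [symLebesgue, symLebesgue, ← (measurePreserving_comp_equiv (sym2Relabel e)).map_eq,
    Measure.map_map measurable_symMatrix (measurePreserving_comp_equiv _).measurable,
    Measure.map_map (measurable_submatrix _ _) measurable_symMatrix]
  rfl

lemma ae_isSymm_symLebesgue : ∀ᵐ A ∂symLebesgue ι, A.IsSymm := by
  refine (ae_map_iff measurable_symMatrix.aemeasurable ?_).2 (ae_of_all _ fun x => ?_)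
  · exact (isClosed_eq (Continuous.matrix_transpose continuous_id) continuous_id).measurableSet
  · ext i j
    simp [symMatrix, Sym2.eq_swap]

lemma lintegral_add_symm_symLebesgue {W : Matrix ι ι ℝ} (hW : W.IsSymm)
    {F : Matrix ι ι ℝ → ℝ≥0∞} (hF : Measurable F) :
    ∫⁻ D, F (D + W) ∂symLebesgue ι = ∫⁻ D, F D ∂symLebesgue ι := by
  have hadd : Measurable fun D : Matrix ι ι ℝ => D + W :=
    (continuous_id.add continuous_const).measurable
  let w : Sym2 ι → ℝ := fun s => Sym2.lift ⟨fun i j => W i j, fun i j => hW.apply j i⟩ s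
  have hw : ∀ x, symMatrix x + W = symMatrix (x + w) := fun x => by
    ext i j; simp [symMatrix, w]
  rw [symLebesgue, lintegral_map (f := fun D => F (D + W)) (hF.comp hadd) measurable_symMatrix,
    lintegral_map hF measurable_symMatrix]
  simp only [hw]
  exact lintegral_add_right_eq_self (fun x => F (symMatrix x)) w

/-- An unordered pair from a disjoint union is a pair from either summand or one mixed pair. -/
noncomputable def sumSym2Equiv (ι κ : Type*) :
    Sym2 ι ⊕ (ι × κ ⊕ Sym2 κ) ≃ Sym2 (ι ⊕ κ) :=
  Equiv.ofBijective
    (Sum.elim (Sym2.map Sum.inl)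
      (Sum.elim (fun a => s(Sum.inl a.1, Sum.inr a.2)) (Sym2.map Sum.inr))) <| by
    constructor
    · rintro (a | a | a) (b | b | b)
      all_goals try induction a
      all_goals try induction b
      all_goals simp [Prod.ext_iff]
    · intro s
      induction s with | _ a b
      rcases a with a | a <;> rcases b with b | b
      · exact ⟨Sum.inl s(a, b), rfl⟩
      · exact ⟨Sum.inr (Sum.inl (a, b)), rfl⟩
      · exact ⟨Sum.inr (Sum.inl (b, a)), Sym2.eq_swap⟩
      · exact ⟨Sum.inr (Sum.inr s(a, b)), rfl⟩

/-- The symmetric block matrix with diagonal blocks `A`, `D` and off-diagonal block `b`. -/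
def symBlocks (A : Matrix ι ι ℝ) (b : ι × κ → ℝ) (D : Matrix κ κ ℝ) :
    Matrix (ι ⊕ κ) (ι ⊕ κ) ℝ :=
  Matrix.fromBlocks A (Matrix.of fun i j => b (i, j)) (Matrix.of fun i j => b (i, j)).transpose D

omit [Fintype ι] [DecidableEq ι] [Fintype κ] [DecidableEq κ] in
lemma measurable_symBlocks : Measurable fun z : Matrix ι ι ℝ × (ι × κ → ℝ) × Matrix κ κ ℝ =>
    symBlocks z.1 z.2.1 z.2.2 := by
  refine measurable_matrix_iff.2 fun i j => ?_
  rcases i with i | i <;> rcases j with j | j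
  · exact (measurable_matrix_apply i j).comp measurable_fst
  · exact (measurable_pi_apply (i, j)).comp (measurable_fst.comp measurable_snd)
  · exact (measurable_pi_apply (j, i)).comp (measurable_fst.comp measurable_snd)
  · exact (measurable_matrix_apply i j).comp (measurable_snd.comp measurable_snd)

/-- In block coordinates `symLebesgue` is the product of the Lebesgue measures of the blocks. -/
lemma symLebesgue_sum : symLebesgue (ι ⊕ κ) =
    ((symLebesgue ι).prod ((volume : Measure (ι × κ → ℝ)).prod (symLebesgue κ))).map
      fun z => symBlocks z.1 z.2.1 z.2.2 := by
  have h₁ := (volume_measurePreserving_sumPiEquivProdPi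
      (fun _ : Sym2 ι ⊕ (ι × κ ⊕ Sym2 κ) => ℝ)).comp
    (measurePreserving_comp_equiv (sumSym2Equiv ι κ))
  have h₂ := ((MeasurePreserving.id (volume : Measure (Sym2 ι → ℝ))).prod
    (volume_measurePreserving_sumPiEquivProdPi (fun _ : ι × κ ⊕ Sym2 κ => ℝ))).comp h₁
  have h₃ : ((symLebesgue ι).prod ((volume : Measure (ι × κ → ℝ)).prod (symLebesgue κ))) =
      ((volume : Measure (Sym2 ι → ℝ)).prod ((volume : Measure (ι × κ → ℝ)).prod
        (volume : Measure (Sym2 κ → ℝ)))).map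
          (Prod.map symMatrix (Prod.map id symMatrix)) := by
    rw [← Measure.map_prod_map _ _ measurable_symMatrix (measurable_id.prodMap measurable_symMatrix),
      ← Measure.map_prod_map _ _ measurable_id measurable_symMatrix, Measure.map_id]
    rfl
  rw [h₃, Measure.map_map measurable_symBlocks
    (measurable_symMatrix.prodMap (measurable_id.prodMap measurable_symMatrix))]
  erw [← h₂.map_eq]
  rw [Measure.map_map (measurable_symBlocks.comp
    (measurable_symMatrix.prodMap (measurable_id.prodMap measurable_symMatrix))) h₂.measurable]
  refine congrArg (fun g => Measure.map g volume) (funext fun x => ?_)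
  ext i j
  rcases i with i | i <;> rcases j with j | j
  · rfl
  · rfl
  · exact congrArg x Sym2.eq_swap
  · rfl

/-- Left multiplication by an invertible `A` scales Lebesgue measure on `ι × κ` matrices by
`|det A| ^ card κ`: it is the Kronecker product of `A` with the identity. -/
lemma lintegral_eq_lintegral_mul_left {A : Matrix ι ι ℝ} (hA : A.det ≠ 0)
    {G : (ι × κ → ℝ) → ℝ≥0∞} (hG : Measurable G) :
    ∫⁻ b, G b = ENNReal.ofReal (|A.det| ^ Fintype.card κ) *
      ∫⁻ u : ι × κ → ℝ, G fun a => (A * Matrix.of fun i j => u (i, j)) a.1 a.2 := by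
  have hdet : (Matrix.kronecker A (1 : Matrix κ κ ℝ)).det = A.det ^ Fintype.card κ := by
    simp [Matrix.det_kronecker]
  have h0 : (Matrix.kronecker A (1 : Matrix κ κ ℝ)).det ≠ 0 := by
    rw [hdet]; exact pow_ne_zero _ hA
  have hmap := Real.map_matrix_volume_pi_eq_smul_volume_pi h0
  have hfun : ∀ u : ι × κ → ℝ, Matrix.toLin' (Matrix.kronecker A (1 : Matrix κ κ ℝ)) u =
      fun a => (A * Matrix.of fun i j => u (i, j)) a.1 a.2 := fun u => by
    ext ⟨i, j⟩
    simp [Matrix.mulVec, dotProduct, Fintype.sum_prod_type, Matrix.mul_apply, Matrix.one_apply]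
  have hl : ∫⁻ u : ι × κ → ℝ, G (fun a => (A * Matrix.of fun i j => u (i, j)) a.1 a.2) =
      ENNReal.ofReal |(A.det ^ Fintype.card κ)⁻¹| * ∫⁻ b, G b := by
    simp_rw [← hfun]
    rw [← lintegral_map hG (LinearMap.continuous_of_finiteDimensional _).measurable, hmap,
      lintegral_smul_measure, hdet, smul_eq_mul]
  rw [hl, ← mul_assoc, ← ENNReal.ofReal_mul (by positivity), ← abs_pow, ← abs_mul,
    mul_inv_cancel₀ (pow_ne_zero _ hA)]
  simp

end SymLebesgue

/-! ### Inverted Wishart kernels -/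

section Kernel

variable {ι κ τ : Type*} [Fintype ι] [DecidableEq ι] [Fintype κ] [DecidableEq κ]
  [Fintype τ] [DecidableEq τ]

/-- The inverted Wishart kernel `|X| ^ (-k) * exp (-tr (M X⁻¹) / 2)` on the positive definite
matrices, extended by `0`. The matrix `M` is arbitrary: no finiteness of the integral is claimed. -/
noncomputable def invWishartKernel (M : Matrix ι ι ℝ) (k : ℝ) : Matrix ι ι ℝ → ℝ≥0∞ :=
  Set.indicator {X | X.PosDef} fun X =>
    ENNReal.ofReal (X.det ^ (-k) * Real.exp (-(1 / 2) * (M * X⁻¹).trace))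

lemma measurable_invWishartKernel (M : Matrix ι ι ℝ) (k : ℝ) :
    Measurable (invWishartKernel M k) := by
  refine Measurable.indicator ?_ measurableSet_posDef
  have h : Measurable fun X : Matrix ι ι ℝ => (M * X⁻¹).trace :=
    (Continuous.matrix_trace (continuous_const.matrix_mul continuous_id)).measurable.comp
      measurable_matrix_inv
  have hd : Measurable fun X : Matrix ι ι ℝ => X.det :=
    (Continuous.matrix_det continuous_id).measurable
  exact ((hd.pow_const _).mul (h.const_mul _).exp).ennreal_ofReal

lemma invWishartKernel_of_posDef (M : Matrix ι ι ℝ) (k : ℝ) {X : Matrix ι ι ℝ} (h : X.PosDef) :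
    invWishartKernel M k X =
      ENNReal.ofReal (X.det ^ (-k) * Real.exp (-(1 / 2) * (M * X⁻¹).trace)) :=
  Set.indicator_of_mem (s := {X : Matrix ι ι ℝ | X.PosDef}) h _

lemma invWishartKernel_of_not_posDef (M : Matrix ι ι ℝ) (k : ℝ) {X : Matrix ι ι ℝ}
    (h : ¬ X.PosDef) : invWishartKernel M k X = 0 :=
  Set.indicator_of_notMem (s := {X : Matrix ι ι ℝ | X.PosDef}) h _

lemma invWishartKernel_ne_top (M : Matrix ι ι ℝ) (k : ℝ) (X : Matrix ι ι ℝ) :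
    invWishartKernel M k X ≠ ∞ := by
  by_cases h : X.PosDef
  · rw [invWishartKernel_of_posDef M k h]; exact ENNReal.ofReal_ne_top
  · rw [invWishartKernel_of_not_posDef M k h]; exact ENNReal.zero_ne_top

/-- A congruence by a unimodular matrix can be transferred from the variable to the scale. -/
lemma invWishartKernel_congruence (M : Matrix ι ι ℝ) (k : ℝ) (X : Matrix ι ι ℝ)
    {L : Matrix ι ι ℝ} (hL : L.det = 1) :
    invWishartKernel M k (L.transpose * X * L) =
      invWishartKernel (L⁻¹.transpose * M * L⁻¹) k X := by
  have hu : IsUnit L := (Matrix.isUnit_iff_isUnit_det L).2 (by rw [hL]; exact isUnit_one)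
  have hiff : (L.transpose * X * L).PosDef ↔ X.PosDef := by
    simpa [Matrix.star_eq_conjTranspose] using
      Matrix.IsUnit.posDef_star_left_conjugate_iff (x := X) hu
  by_cases h : X.PosDef
  · rw [invWishartKernel_of_posDef _ _ h, invWishartKernel_of_posDef _ _ (hiff.2 h)]
    have hdet : (L.transpose * X * L).det = X.det := by simp [hL]
    have htr : (M * (L.transpose * X * L)⁻¹).trace =
        (L⁻¹.transpose * M * L⁻¹ * X⁻¹).trace := by
      rw [Matrix.mul_inv_rev, Matrix.mul_inv_rev, ← Matrix.transpose_nonsing_inv,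
        Matrix.mul_assoc (_ * M), Matrix.mul_assoc L⁻¹.transpose, Matrix.trace_mul_comm L⁻¹.transpose]
      simp only [Matrix.mul_assoc]
    rw [hdet, htr]
  · rw [invWishartKernel_of_not_posDef _ _ h, invWishartKernel_of_not_posDef _ _ (mt hiff.1 h)]

lemma posDef_fromBlocks_diagonal_iff {A : Matrix ι ι ℝ} {D : Matrix κ κ ℝ} :
    (Matrix.fromBlocks A 0 0 D).PosDef ↔ A.PosDef ∧ D.PosDef := by
  constructor
  · intro h
    exact ⟨h.submatrix Sum.inl_injective, h.submatrix Sum.inr_injective⟩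
  · rintro ⟨hA, hD⟩
    let _ := hA.isUnit.invertible
    have h : (Matrix.fromBlocks A 0 0 D).PosSemidef := by
      simpa using (Matrix.PosDef.fromBlocks₁₁ (0 : Matrix ι κ ℝ) D hA).2
        (by simpa using hD.posSemidef)
    refine h.posDef_iff_det_ne_zero.2 ?_
    rw [Matrix.det_fromBlocks_zero₂₁]
    exact mul_ne_zero hA.det_pos.ne' hD.det_pos.ne'

lemma invWishartKernel_fromBlocks_diagonal (M : Matrix (ι ⊕ κ) (ι ⊕ κ) ℝ) (k : ℝ)
    (A : Matrix ι ι ℝ) (D : Matrix κ κ ℝ) :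
    invWishartKernel M k (Matrix.fromBlocks A 0 0 D) =
      invWishartKernel M.toBlocks₁₁ k A * invWishartKernel M.toBlocks₂₂ k D := by
  by_cases hA : A.PosDef
  · by_cases hD : D.PosDef
    · rw [invWishartKernel_of_posDef _ _ hA, invWishartKernel_of_posDef _ _ hD,
        invWishartKernel_of_posDef _ _ (posDef_fromBlocks_diagonal_iff.2 ⟨hA, hD⟩),
        ← ENNReal.ofReal_mul (by have := hA.det_pos; positivity)]
      have hinv : (Matrix.fromBlocks A 0 0 D)⁻¹ = Matrix.fromBlocks A⁻¹ 0 0 D⁻¹ := by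
        rw [Matrix.inv_fromBlocks_zero₂₁_of_isUnit_iff A 0 D (iff_of_true hA.isUnit hD.isUnit)]
        simp
      have htr : (M * (Matrix.fromBlocks A 0 0 D)⁻¹).trace =
          (M.toBlocks₁₁ * A⁻¹).trace + (M.toBlocks₂₂ * D⁻¹).trace := by
        rw [hinv]
        nth_rw 1 [← M.fromBlocks_toBlocks]
        rw [Matrix.fromBlocks_multiply, Matrix.trace, Fintype.sum_sum_type]
        simp [Matrix.trace]
      rw [htr, Matrix.det_fromBlocks_zero₂₁, Real.mul_rpow hA.det_pos.le hD.det_pos.le, mul_add,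
        Real.exp_add]
      congr 1
      ring
    · rw [invWishartKernel_of_not_posDef _ _ hD, mul_zero, invWishartKernel_of_not_posDef]
      exact fun h => hD (posDef_fromBlocks_diagonal_iff.1 h).2
  · rw [invWishartKernel_of_not_posDef _ _ hA, zero_mul, invWishartKernel_of_not_posDef]
    exact fun h => hA (posDef_fromBlocks_diagonal_iff.1 h).1

/-- The lower right block of `L⁻ᵀ M L⁻¹` for the block shear `L` with off-diagonal block `U`. It
depends on the regression coefficients `U` only. -/
def residualScale (M : Matrix (ι ⊕ κ) (ι ⊕ κ) ℝ) (U : Matrix ι κ ℝ) : Matrix κ κ ℝ :=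
  ((Matrix.fromBlocks 1 (-U) 0 1).transpose * M * Matrix.fromBlocks 1 (-U) 0 1).toBlocks₂₂

/-- In the coordinates `U = A⁻¹ B`, `T = D - Bᵀ A⁻¹ B` the kernel splits into a factor in `A` and
a factor in `(U, T)`. -/
lemma invWishartKernel_regression (M : Matrix (ι ⊕ κ) (ι ⊕ κ) ℝ) (k : ℝ)
    {A : Matrix ι ι ℝ} (hA : A.IsSymm) (U : Matrix ι κ ℝ) (T : Matrix κ κ ℝ) :
    invWishartKernel M k (Matrix.fromBlocks A (A * U) (A * U).transpose
        (T + U.transpose * A * U)) =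
      invWishartKernel M.toBlocks₁₁ k A * invWishartKernel (residualScale M U) k T := by
  set L : Matrix (ι ⊕ κ) (ι ⊕ κ) ℝ := Matrix.fromBlocks 1 U 0 1 with hL
  have hLinv : L⁻¹ = Matrix.fromBlocks 1 (-U) 0 1 := by
    refine Matrix.inv_eq_right_inv ?_
    rw [hL, Matrix.fromBlocks_multiply, ← Matrix.fromBlocks_one]
    simp
  have hfac : Matrix.fromBlocks A (A * U) (A * U).transpose (T + U.transpose * A * U) =
      L.transpose * Matrix.fromBlocks A 0 0 T * L := by
    rw [hL, Matrix.fromBlocks_transpose, Matrix.fromBlocks_multiply, Matrix.fromBlocks_multiply,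
      Matrix.transpose_mul, hA.eq]
    simp [add_comm]
  rw [hfac, invWishartKernel_congruence M k _ (by simp [hL]),
    invWishartKernel_fromBlocks_diagonal, hLinv]
  congr 2
  nth_rw 1 [← M.fromBlocks_toBlocks]
  rw [Matrix.fromBlocks_transpose, Matrix.fromBlocks_multiply, Matrix.fromBlocks_multiply]
  simp

/-- The Jacobian `|det A| ^ r` is absorbed by lowering the exponent parameter by `r`. -/
lemma ofReal_det_pow_mul_invWishartKernel (M : Matrix ι ι ℝ) (k : ℝ) (r : ℕ) (A : Matrix ι ι ℝ) :
    ENNReal.ofReal (|A.det| ^ r) * invWishartKernel M k A = invWishartKernel M (k - r) A := by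
  by_cases h : A.PosDef
  · rw [invWishartKernel_of_posDef _ _ h, invWishartKernel_of_posDef _ _ h,
      ← ENNReal.ofReal_mul (by positivity), ← mul_assoc, abs_of_pos h.det_pos,
      ← Real.rpow_natCast, ← Real.rpow_add h.det_pos]
    congr 4
    ring
  · rw [invWishartKernel_of_not_posDef _ _ h, invWishartKernel_of_not_posDef _ _ h, mul_zero]

/-- Integrating out the lower right block after the substitution `B = A U`: the Schur complement
`T` is a translate of that block. -/
lemma lintegral_invWishartKernel_symBlocks_mul (M : Matrix (ι ⊕ κ) (ι ⊕ κ) ℝ) (k : ℝ)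
    {A : Matrix ι ι ℝ} (hA : A.IsSymm) (U : Matrix ι κ ℝ) :
    ∫⁻ D, invWishartKernel M k (symBlocks A (fun a => (A * U) a.1 a.2) D) ∂symLebesgue κ =
      invWishartKernel M.toBlocks₁₁ k A *
        ∫⁻ T, invWishartKernel (residualScale M U) k T ∂symLebesgue κ := by
  have hblocks : ∀ D, symBlocks A (fun a => (A * U) a.1 a.2) D =
      Matrix.fromBlocks A (A * U) (A * U).transpose D := fun D => rfl
  have hW : (U.transpose * A * U).IsSymm := by
    rw [Matrix.IsSymm, Matrix.transpose_mul, Matrix.transpose_mul, hA.eq,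
      Matrix.transpose_transpose, Matrix.mul_assoc]
  have hm : Measurable fun D : Matrix κ κ ℝ => symBlocks A (fun a => (A * U) a.1 a.2) D :=
    measurable_symBlocks.comp
      (g := fun z : Matrix ι ι ℝ × (ι × κ → ℝ) × Matrix κ κ ℝ => symBlocks z.1 z.2.1 z.2.2)
      (f := fun D => (A, fun a : ι × κ => (A * U) a.1 a.2, D))
      (measurable_const.prodMk (measurable_const.prodMk measurable_id))
  have hU : Measurable fun D : Matrix κ κ ℝ =>
      invWishartKernel M k (symBlocks A (fun a => (A * U) a.1 a.2) D) :=
    (measurable_invWishartKernel M k).comp hm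
  rw [← lintegral_add_symm_symLebesgue hW hU,
    ← lintegral_const_mul' _ _ (invWishartKernel_ne_top _ _ _)]
  simp only [hblocks, invWishartKernel_regression M k hA U]

/-- Integrating out the blocks other than `A`. -/
lemma lintegral_invWishartKernel_symBlocks (M : Matrix (ι ⊕ κ) (ι ⊕ κ) ℝ) (k : ℝ)
    {A : Matrix ι ι ℝ} (hA : A.IsSymm) :
    ∫⁻ b : ι × κ → ℝ, ∫⁻ D, invWishartKernel M k (symBlocks A b D) ∂symLebesgue κ =
      invWishartKernel M.toBlocks₁₁ (k - Fintype.card κ) A *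
        ∫⁻ u : ι × κ → ℝ, ∫⁻ T,
          invWishartKernel (residualScale M (Matrix.of fun i j => u (i, j))) k T ∂symLebesgue κ := by
  by_cases hpd : A.PosDef
  · have hmeas : Measurable fun z : (ι × κ → ℝ) × Matrix κ κ ℝ =>
        invWishartKernel M k (symBlocks A z.1 z.2) :=
      (measurable_invWishartKernel M k).comp (measurable_symBlocks.comp measurable_prodMk_left)
    rw [lintegral_eq_lintegral_mul_left hpd.det_pos.ne' hmeas.lintegral_prod_right',
      ← ofReal_det_pow_mul_invWishartKernel, mul_assoc,
      ← lintegral_const_mul' _ _ (invWishartKernel_ne_top _ _ _)]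
    congr 1
    exact lintegral_congr fun u => lintegral_invWishartKernel_symBlocks_mul M k hA _
  · rw [invWishartKernel_of_not_posDef _ _ hpd, zero_mul]
    have h0 : ∀ (b : ι × κ → ℝ) D, invWishartKernel M k (symBlocks A b D) = 0 := fun b D =>
      invWishartKernel_of_not_posDef M k fun h => hpd (h.submatrix Sum.inl_injective)
    simp [h0]

/-- The constant is the integral of the factor in `(U, T)`. It is not evaluated and may be
infinite: a total mass fixes it later. -/
lemma exists_map_toBlocks₁₁_invWishart (M : Matrix (ι ⊕ κ) (ι ⊕ κ) ℝ) (k : ℝ) :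
    ∃ C : ℝ≥0∞, Measure.map (fun X : Matrix (ι ⊕ κ) (ι ⊕ κ) ℝ => X.submatrix Sum.inl Sum.inl)
        ((symLebesgue (ι ⊕ κ)).withDensity (invWishartKernel M k)) =
      C • (symLebesgue ι).withDensity
        (invWishartKernel M.toBlocks₁₁ (k - Fintype.card κ)) := by
  refine ⟨∫⁻ u : ι × κ → ℝ, ∫⁻ T, invWishartKernel
    (residualScale M (Matrix.of fun i j => u (i, j))) k T ∂symLebesgue κ,
    Measure.ext fun s hs => ?_⟩
  have hpre : MeasurableSet ((fun X : Matrix (ι ⊕ κ) (ι ⊕ κ) ℝ =>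
      X.submatrix Sum.inl Sum.inl) ⁻¹' s) := measurable_submatrix _ _ hs
  have hk := measurable_invWishartKernel M k
  have hkz : Measurable fun z : Matrix ι ι ℝ × (ι × κ → ℝ) × Matrix κ κ ℝ =>
      invWishartKernel M k (symBlocks z.1 z.2.1 z.2.2) := hk.comp measurable_symBlocks
  rw [Measure.map_apply (measurable_submatrix _ _) hs, withDensity_apply _ hpre,
    ← lintegral_indicator hpre, symLebesgue_sum,
    lintegral_map (hk.indicator hpre) measurable_symBlocks,
    lintegral_prod (fun z : Matrix ι ι ℝ × (ι × κ → ℝ) × Matrix κ κ ℝ =>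
      ((fun X : Matrix (ι ⊕ κ) (ι ⊕ κ) ℝ => X.submatrix Sum.inl Sum.inl) ⁻¹' s).indicator
        (invWishartKernel M k) (symBlocks z.1 z.2.1 z.2.2))
      ((hk.indicator hpre).comp measurable_symBlocks).aemeasurable,
    Measure.smul_apply, smul_eq_mul, withDensity_apply _ hs, ← lintegral_indicator hs, mul_comm,
    ← lintegral_mul_const _ ((measurable_invWishartKernel _ _).indicator hs)]
  refine lintegral_congr_ae (ae_isSymm_symLebesgue.mono fun A hA => ?_)
  by_cases hAs : A ∈ s
  · have h1 : ∀ z : (ι × κ → ℝ) × Matrix κ κ ℝ, symBlocks A z.1 z.2 ∈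
        ((fun X : Matrix (ι ⊕ κ) (ι ⊕ κ) ℝ => X.submatrix Sum.inl Sum.inl) ⁻¹' s) := fun z => hAs
    simp only [Set.indicator_of_mem (h1 _), Set.indicator_of_mem hAs]
    have hkA : Measurable fun z : (ι × κ → ℝ) × Matrix κ κ ℝ =>
        invWishartKernel M k (symBlocks A z.1 z.2) := hkz.comp measurable_prodMk_left
    rw [lintegral_prod _ hkA.aemeasurable]
    exact lintegral_invWishartKernel_symBlocks M k hA
  · have h1 : ∀ z : (ι × κ → ℝ) × Matrix κ κ ℝ, symBlocks A z.1 z.2 ∉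
        ((fun X : Matrix (ι ⊕ κ) (ι ⊕ κ) ℝ => X.submatrix Sum.inl Sum.inl) ⁻¹' s) := fun z => hAs
    simp only [Set.indicator_of_notMem (h1 _), Set.indicator_of_notMem hAs]
    simp

lemma invWishartKernel_submatrix_equiv (M : Matrix τ τ ℝ) (k : ℝ) (e : ι ≃ τ) (X : Matrix τ τ ℝ) :
    invWishartKernel (M.submatrix e e) k (X.submatrix e e) = invWishartKernel M k X := by
  have hiff : (X.submatrix e e).PosDef ↔ X.PosDef :=
    ⟨fun h => by simpa using h.submatrix e.symm.injective, fun h => h.submatrix e.injective⟩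
  by_cases h : X.PosDef
  · rw [invWishartKernel_of_posDef _ _ h, invWishartKernel_of_posDef _ _ (hiff.2 h),
      Matrix.det_submatrix_equiv_self, Matrix.inv_submatrix_equiv, Matrix.submatrix_mul_equiv]
    congr 4
    exact e.sum_comp fun i => (M * X⁻¹) i i
  · rw [invWishartKernel_of_not_posDef _ _ h, invWishartKernel_of_not_posDef _ _ (mt hiff.1 h)]

/-- A principal block, along any injection of index types, of a matrix with inverted Wishart
density again has an inverted Wishart density, up to a constant factor. -/
lemma exists_map_submatrix_invWishart {f : ι → τ} (hf : Function.Injective f)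
    (M : Matrix τ τ ℝ) (k : ℝ) :
    ∃ C : ℝ≥0∞, Measure.map (fun X : Matrix τ τ ℝ => X.submatrix f f)
        ((symLebesgue τ).withDensity (invWishartKernel M k)) =
      C • (symLebesgue ι).withDensity (invWishartKernel (M.submatrix f f)
        (k - (Fintype.card τ - Fintype.card ι))) := by
  classical
  let e : ι ⊕ ((Set.range f)ᶜ : Set τ) ≃ τ :=
    ((Equiv.ofInjective f hf).sumCongr (Equiv.refl _)).trans (Equiv.Set.sumCompl (Set.range f))
  have hef : ∀ i, e (Sum.inl i) = f i := fun i => by simp [e]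
  have hcard : (Fintype.card ((Set.range f)ᶜ : Set τ) : ℝ) =
      Fintype.card τ - Fintype.card ι := by
    rw [← Fintype.card_congr e, Fintype.card_sum]; push_cast; ring
  obtain ⟨C, hC⟩ := exists_map_toBlocks₁₁_invWishart (M.submatrix e e) k
  refine ⟨C, ?_⟩
  have hM : (M.submatrix e e).toBlocks₁₁ = M.submatrix f f := by
    ext i j; simp [Matrix.toBlocks₁₁, hef]
  rw [hcard, hM] at hC
  rw [← hC]
  have hmap : (symLebesgue _).withDensity (invWishartKernel (M.submatrix e e) k) =
      ((symLebesgue τ).withDensity (invWishartKernel M k)).map fun X => X.submatrix e e := by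
    refine Measure.ext fun s hs => ?_
    have hs' := measurable_submatrix (e : _ → τ) e hs
    rw [Measure.map_apply (measurable_submatrix _ _) hs, withDensity_apply _ hs,
      withDensity_apply _ hs', ← map_submatrix_symLebesgue e,
      setLIntegral_map hs (measurable_invWishartKernel _ _) (measurable_submatrix _ _)]
    simp only [invWishartKernel_submatrix_equiv]
  rw [hmap, Measure.map_map (measurable_submatrix _ _) (measurable_submatrix _ _)]
  refine congrArg (fun g => Measure.map g _) (funext fun X => ?_)
  ext i j; simp [hef]

end Kernel

/-! ### Laws of principal blocks -/

lemma miwKernel_eq_invWishartKernel {p : ℕ} (S N : Matrix (Fin p) (Fin p) ℝ) (v : ℝ) :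
    miwKernel S N v =
      invWishartKernel (diagSqrt N * S * diagSqrt N) (v + N.trace / (2 * p)) := rfl

lemma miwMeasure_eq_smul {p : ℕ} (S N : Matrix (Fin p) (Fin p) ℝ) (v : ℝ) :
    miwMeasure S N v = (∫⁻ Y, miwKernel S N v Y ∂symVolume p)⁻¹ •
      (symVolume p).withDensity (miwKernel S N v) :=
  withDensity_smul _ (measurable_invWishartKernel _ _)

/-- Among the multiples of the kernel measure, `miwMeasure` is characterised by its total mass. -/
lemma eq_miwMeasure_of_eq_smul {p : ℕ} {S N : Matrix (Fin p) (Fin p) ℝ} {v : ℝ}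
    {μ : Measure (Matrix (Fin p) (Fin p) ℝ)} [IsProbabilityMeasure μ] {C : ℝ≥0∞}
    (h : μ = C • (symVolume p).withDensity (miwKernel S N v)) : μ = miwMeasure S N v := by
  have h1 : C * ∫⁻ Y, miwKernel S N v Y ∂symVolume p = 1 := by
    rw [← measure_univ (μ := μ), h, Measure.smul_apply, withDensity_apply _ MeasurableSet.univ,
      setLIntegral_univ, smul_eq_mul]
  rw [miwMeasure_eq_smul, ← ENNReal.eq_inv_of_mul_eq_one_left h1, h]

lemma diagSqrt_mul_mul_diagSqrt_submatrix {p q : ℕ} (f : Fin q → Fin p)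
    (S N : Matrix (Fin p) (Fin p) ℝ) :
    (diagSqrt N * S * diagSqrt N).submatrix f f =
      diagSqrt (N.submatrix f f) * S.submatrix f f * diagSqrt (N.submatrix f f) := by
  ext i j
  simp [diagSqrt]

/-- A principal block along an injection `f` keeps the parameters of the block. The exponent
`v + tr N / (2 p)` drops by the number `p - q` of deleted indices. -/
lemma HasMIWLaw.submatrix {Ω : Type*} [MeasurableSpace Ω] {P : Measure Ω} [IsProbabilityMeasure P]
    {p q : ℕ} {S N : Matrix (Fin p) (Fin p) ℝ} {v w : ℝ} {X : Ω → Matrix (Fin p) (Fin p) ℝ}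
    (hX : HasMIWLaw X S N v P) {f : Fin q → Fin p} (hf : Function.Injective f)
    (hw : w + (N.submatrix f f).trace / (2 * q) = v + N.trace / (2 * p) - (p - q)) :
    HasMIWLaw (fun ω => (X ω).submatrix f f) (S.submatrix f f) (N.submatrix f f) w P where
  posDef := hX.posDef.submatrix hf
  isDiag := hX.isDiag.submatrix hf
  diag_pos i := hX.diag_pos (f i)
  two_mul_lt := by
    have h := hX.two_mul_lt
    have h2 : ∀ x y : ℝ, x / (2 * y) = x / y / 2 := fun x y => by rw [mul_comm, div_div]
    rw [h2, h2] at hw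
    linarith
  hasLaw := by
    have hm : Measurable fun Y : Matrix (Fin p) (Fin p) ℝ => Y.submatrix f f :=
      measurable_submatrix f f
    have hae : AEMeasurable (fun ω => (X ω).submatrix f f) P :=
      hm.comp_aemeasurable hX.hasLaw.aemeasurable
    refine ⟨hae, ?_⟩
    have := Measure.isProbabilityMeasure_map hae
    obtain ⟨C, hC⟩ := exists_map_submatrix_invWishart hf (diagSqrt N * S * diagSqrt N)
      (v + N.trace / (2 * p))
    refine eq_miwMeasure_of_eq_smul (C := (∫⁻ Y, miwKernel S N v Y ∂symVolume p)⁻¹ * C) ?_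
    calc P.map (fun ω => (X ω).submatrix f f)
        = (P.map X).map (fun Y => Y.submatrix f f) :=
          (AEMeasurable.map_map_of_aemeasurable hm.aemeasurable hX.hasLaw.aemeasurable).symm
      _ = _ := by
          rw [hX.hasLaw.map_eq, miwMeasure_eq_smul, Measure.map_smul, symVolume_eq_symLebesgue,
            symVolume_eq_symLebesgue, miwKernel_eq_invWishartKernel,
            miwKernel_eq_invWishartKernel, hC, smul_smul, hw,
            diagSqrt_mul_mul_diagSqrt_submatrix, Fintype.card_fin, Fintype.card_fin]

/-! ### The inverted gamma distribution -/

/-- The total mass is that of the gamma distribution after the substitution `x ↦ x⁻¹`. -/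
lemma isProbabilityMeasure_invGammaMeasure {a b : ℝ} (ha : 0 < a) (hb : 0 < b) :
    IsProbabilityMeasure (invGammaMeasure a b) := by
  constructor
  rw [invGammaMeasure, withDensity_apply _ MeasurableSet.univ, setLIntegral_univ,
    lintegral_indicator measurableSet_Ioi]
  have himage : (fun x : ℝ => x⁻¹) '' Set.Ioi 0 = Set.Ioi 0 := by
    rw [Set.image_inv_eq_inv]
    ext x
    simp
  have hsub := lintegral_image_eq_lintegral_abs_deriv_mul (s := Set.Ioi (0 : ℝ))
    (f := fun x => x⁻¹) (f' := fun x => -(x ^ 2)⁻¹) measurableSet_Ioi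
    (fun x hx => (hasDerivAt_inv (ne_of_gt hx)).hasDerivWithinAt)
    (inv_injective.injOn) (gammaPDF a b)
  rw [himage] at hsub
  have hgamma : ∫⁻ x in Set.Ioi 0, gammaPDF a b x = 1 := by
    have hsupp : (Set.Ici (0 : ℝ)).indicator (gammaPDF a b) = gammaPDF a b :=
      Set.indicator_eq_self.2 fun x hx => not_lt.1 fun h => hx (gammaPDF_of_neg h)
    rw [setLIntegral_congr Ioi_ae_eq_Ici, ← lintegral_indicator measurableSet_Ici, hsupp,
      lintegral_gammaPDF_eq_one ha hb]
  rw [← hgamma, hsub]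
  refine setLIntegral_congr_fun measurableSet_Ioi fun x hx => ?_
  have hx : 0 < x := hx
  rw [gammaPDF_of_nonneg (inv_pos.2 hx).le, ← ENNReal.ofReal_mul (abs_nonneg _)]
  congr 1
  have hpow : x ^ (-(a + 1)) = (x ^ 2)⁻¹ * x⁻¹ ^ (a - 1) := by
    rw [Real.inv_rpow hx.le, ← Real.rpow_natCast, ← Real.rpow_neg hx.le, ← Real.rpow_neg hx.le,
      ← Real.rpow_add hx]
    congr 1
    push_cast
    ring
  rw [hpow, abs_neg, abs_of_pos (by positivity), div_eq_mul_inv b x]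
  ring

lemma posDef_of_fin_one_iff {x : ℝ} : (!![x] : Matrix (Fin 1) (Fin 1) ℝ).PosDef ↔ 0 < x := by
  have h : (!![x] : Matrix (Fin 1) (Fin 1) ℝ) = Matrix.diagonal fun _ => x := by
    ext i j; fin_cases i; fin_cases j; simp
  rw [h, Matrix.posDef_diagonal_iff]
  simp

lemma map_entry_symLebesgue_fin_one :
    (symLebesgue (Fin 1)).map (fun Y => Y 0 0) = volume := by
  have hd : ∀ s : Sym2 (Fin 1), s = s(0, 0) := fun s => Subsingleton.elim _ _
  let _ : Unique (Sym2 (Fin 1)) := ⟨⟨s(0, 0)⟩, hd⟩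
  rw [symLebesgue, Measure.map_map (measurable_matrix_apply 0 0) measurable_symMatrix,
    ← (volume_preserving_funUnique (Sym2 (Fin 1)) ℝ).map_eq]
  rfl

lemma eq_of_fin_one (Y : Matrix (Fin 1) (Fin 1) ℝ) : Y = !![Y 0 0] := by
  ext i j; fin_cases i; fin_cases j; rfl

/-- In dimension one the kernel measure is, up to its constant, an inverted gamma law. -/
lemma map_entry_miw_fin_one {S N : Matrix (Fin 1) (Fin 1) ℝ} {v : ℝ} (hN : 0 ≤ N 0 0) :
    ((symVolume 1).withDensity (miwKernel S N v)).map (fun Y => Y 0 0) =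
      volume.withDensity (Set.indicator (Set.Ioi 0) fun x => ENNReal.ofReal
        (x ^ (-(v + N 0 0 / 2)) * Real.exp (-(N 0 0 * S 0 0 / 2 / x)))) := by
  have hentry : Measurable fun Y : Matrix (Fin 1) (Fin 1) ℝ => Y 0 0 := measurable_matrix_apply 0 0
  have hk : ∀ Y, miwKernel S N v Y = (Set.indicator (Set.Ioi 0) fun x => ENNReal.ofReal
        (x ^ (-(v + N 0 0 / 2)) * Real.exp (-(N 0 0 * S 0 0 / 2 / x)))) (Y 0 0) := fun Y => by
    rw [eq_of_fin_one Y, miwKernel_eq_invWishartKernel]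
    by_cases h : 0 < Y 0 0
    · rw [invWishartKernel_of_posDef _ _ (posDef_of_fin_one_iff.2 h)]
      simp only [Matrix.of_apply, Matrix.cons_val', Matrix.cons_val_fin_one]
      rw [Set.indicator_of_mem (Set.mem_Ioi.2 h)]
      have htr : (diagSqrt N * S * diagSqrt N * (!![Y 0 0])⁻¹).trace = N 0 0 * S 0 0 / Y 0 0 := by
        have hinv : (!![Y 0 0] : Matrix (Fin 1) (Fin 1) ℝ)⁻¹ = !![(Y 0 0)⁻¹] := by
          refine Matrix.inv_eq_right_inv ?_
          ext i j; fin_cases i; fin_cases j; simp [Matrix.mul_apply, h.ne']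
        rw [hinv]
        simp only [Matrix.trace, Matrix.mul_apply, diagSqrt, Matrix.diag, Finset.univ_unique,
          Finset.sum_singleton, Fin.default_eq_zero, Matrix.diagonal_apply_eq, Matrix.of_apply,
          Matrix.cons_val_zero]
        rw [mul_right_comm _ (S 0 0), Real.mul_self_sqrt hN, div_eq_mul_inv]
      rw [htr, Matrix.det_fin_one_of]
      congr 3
      · simp [Matrix.trace]
      · ring
    · rw [invWishartKernel_of_not_posDef _ _ (mt posDef_of_fin_one_iff.1 h),
        Set.indicator_of_notMem]
      simpa using h
  refine Measure.ext fun s hs => ?_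
  have hg : Measurable (Set.indicator (Set.Ioi 0) fun x : ℝ => ENNReal.ofReal
      (x ^ (-(v + N 0 0 / 2)) * Real.exp (-(N 0 0 * S 0 0 / 2 / x)))) :=
    Measurable.indicator (by fun_prop) measurableSet_Ioi
  rw [Measure.map_apply hentry hs, withDensity_apply _ (hentry hs), withDensity_apply _ hs,
    ← map_entry_symLebesgue_fin_one, setLIntegral_map hs hg hentry, symVolume_eq_symLebesgue]
  simp only [hk]

theorem HasMIWLaw.hasInvGammaLaw {Ω : Type*} [MeasurableSpace Ω] {P : Measure Ω}
    [IsProbabilityMeasure P] {S N : Matrix (Fin 1) (Fin 1) ℝ} {v : ℝ}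
    {Y : Ω → Matrix (Fin 1) (Fin 1) ℝ} (hY : HasMIWLaw Y S N v P) :
    HasInvGammaLaw (fun ω => Y ω 0 0) (v + N 0 0 / 2 - 1) (N 0 0 * S 0 0 / 2) P := by
  have ha : 0 < v + N 0 0 / 2 - 1 := by
    have := hY.two_mul_lt
    simp [Matrix.trace] at this
    linarith
  have hN := hY.diag_pos 0
  have hb : 0 < N 0 0 * S 0 0 / 2 := by
    have := mul_pos hN (hY.posDef.diag_pos (i := 0))
    positivity
  have hentry : Measurable fun Y : Matrix (Fin 1) (Fin 1) ℝ => Y 0 0 := measurable_matrix_apply 0 0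
  have hae : AEMeasurable (fun ω => Y ω 0 0) P := hentry.comp_aemeasurable hY.hasLaw.aemeasurable
  refine ⟨ha, hb, hae, ?_⟩
  set a := v + N 0 0 / 2 - 1 with ha_def
  set b := N 0 0 * S 0 0 / 2
  set μ := volume.withDensity (Set.indicator (Set.Ioi 0) fun x : ℝ => ENNReal.ofReal
    (x ^ (-(a + 1)) * Real.exp (-(b / x)))) with hμ
  have hlaw : P.map (fun ω => Y ω 0 0) =
      (∫⁻ Y, miwKernel S N v Y ∂symVolume 1)⁻¹ • μ := by
    calc P.map (fun ω => Y ω 0 0) = (P.map Y).map (fun Y => Y 0 0) :=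
          (AEMeasurable.map_map_of_aemeasurable hentry.aemeasurable hY.hasLaw.aemeasurable).symm
      _ = _ := by
          rw [hY.hasLaw.map_eq, miwMeasure_eq_smul, Measure.map_smul, map_entry_miw_fin_one hN.le,
            hμ, ha_def, sub_add_cancel]
  have hinvGamma : invGammaMeasure a b = ENNReal.ofReal (b ^ a / Real.Gamma a) • μ := by
    rw [hμ, ← withDensity_smul _ (Measurable.indicator (by fun_prop) measurableSet_Ioi),
      invGammaMeasure]
    congr 1
    ext x
    by_cases hx : x ∈ Set.Ioi 0 <;> simp only [Pi.smul_apply, smul_eq_mul, hx, not_false_eq_true,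
      Set.indicator_of_mem, Set.indicator_of_notMem, mul_zero]
    have hc : 0 ≤ b ^ a / Real.Gamma a :=
      div_nonneg (Real.rpow_nonneg hb.le _) (Real.Gamma_pos_of_pos ha).le
    simp only [← ENNReal.ofReal_mul hc, mul_assoc]
  -- Two probability measures proportional to `μ` coincide.
  have h1 := Measure.isProbabilityMeasure_map hae
  have h2 := isProbabilityMeasure_invGammaMeasure ha hb
  have hmass1 := h1.measure_univ
  have hmass2 := h2.measure_univ
  rw [hlaw, Measure.smul_apply, smul_eq_mul] at hmass1
  rw [hinvGamma, Measure.smul_apply, smul_eq_mul] at hmass2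
  rw [hlaw, hinvGamma, ENNReal.eq_inv_of_mul_eq_one_left hmass1,
    ENNReal.eq_inv_of_mul_eq_one_left hmass2]

theorem proposition3 {Ω : Type*} [MeasurableSpace Ω] (P : Measure Ω) [IsProbabilityMeasure P]
    (p : ℕ) (S N : Matrix (Fin p) (Fin p) ℝ) (v : ℝ)
    (X : Ω → Matrix (Fin p) (Fin p) ℝ) (hX : HasMIWLaw X S N v P) :
    (∀ (q : ℕ) (_ : 1 ≤ q) (hqp : q < p),
      HasMIWLaw (fun ω => leadingBlock hqp.le (X ω))
        (leadingBlock hqp.le S) (leadingBlock hqp.le N)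
        (v - p + q + N.trace / (2 * p) - (leadingBlock hqp.le N).trace / (2 * q)) P) ∧
    (∀ (i : Fin p) (w : ℝ), w = v - p + 1 + N.trace / (2 * p) - N i i / 2 →
      HasMIWLaw (fun ω => !![X ω i i]) !![S i i] !![N i i] w P ∧
      HasInvGammaLaw (fun ω => X ω i i) (w + N i i / 2 - 1) (N i i * S i i / 2) P) := by
  refine ⟨fun q _ hqp => ?_, fun i w hw => ?_⟩
  · refine hX.submatrix (Fin.castLE_injective hqp.le) ?_
    simp only [leadingBlock]
    ring
  · have hblock : ∀ A : Matrix (Fin p) (Fin p) ℝ,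
        A.submatrix (fun _ : Fin 1 => i) (fun _ => i) = !![A i i] := fun A => by
      ext a b; fin_cases a; fin_cases b; rfl
    have h : HasMIWLaw (fun ω => !![X ω i i]) !![S i i] !![N i i] w P := by
      have := hX.submatrix (w := w) (Function.injective_of_subsingleton fun _ : Fin 1 => i) (by
        rw [hw, hblock]; simp [Matrix.trace]; ring)
      simpa only [hblock] using this
    exact ⟨h, by simpa using h.hasInvGammaLaw⟩
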